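/- Let $d:[0,\infty)\to\mathbb{R}$ be a one-hop cost with $d(0)>0$, $d$ convex and non-decreasing, and $d(r+\delta)-d(r)\to\infty$ as $r\to\infty$ for every $\delta>0$. Write $d(x,y)=d(\sqrt{x^2+y^2})$ and assume that for $x,y>0$ the function $d(x,y)$ is positive and twice continuously differentiable with $d_{xx}>0$, $d_{xy}\ge 0$, $d_{yy}>0$. Let $0<p<1$, $0\le q\le 1$, $\lambda\ge 0$. A random lattice path starts at $(0,0)$; it always makes one more step, which is Eastward ($(m,n)\to(m+1,n)$) with probability $q$ and Northward ($(m,n)\to(m,n+1)$) with probability $1-q$, and with probability $p$, independently of everything else, this step is the last one. At each vertex of the path before its end (including the start) one decides, possibly with randomization and on the basis of the path so far and of the earlier decisions, whether to place a relay there; a source is placed at the end of the path. If $N$ relays are placed and $r_0,\dots,r_N$ are the successive Euclidean distances between the origin, the relays in order, and the source, put $C=\sum_{i=0}^N d(r_i)$. Let $J_\lambda(0,0)=\inf_\pi\big(\mathbb{E}_\pi C+\lambda\,\mathbb{E}_\pi N\big)$, the infimum being over all such policies $\pi$. For $m,n\in\mathbb{Z}_+$ let $\Delta_q(m,n)=q\,(d(m+1,n)-d(m,n))+(1-q)\,(d(m,n+1)-d(m,n))$,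 and for $h\ge 0$ let $\mathcal{P}(h)=\{(m,n)\in\mathbb{Z}_+^2: p(\lambda+h)\le\Delta_q(m,n)\}$. Let $g(h)$ be the cost $\mathbb{E}_\pi C+\lambda\,\mathbb{E}_\pi N$ of the policy $\pi$ that places a relay exactly when the displacement $(m,n)$ from the previous relay (or from the origin, if there is none yet) lies in $\mathcal{P}(h)$. Then $g(h)<\infty$ for all $h\ge 0$, $g^*:=J_\lambda(0,0)$ is finite, and $g^*=\min_{h\ge 0}g(h)$. Moreover $g^*$ is the unique fixed point of $g$: $g(g^*)=g^*$, and if $h\ge 0$ and $g(h)=h$ then $h=g^*$. Finally, if $h>g^*$ then $g(h)<h$. -/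

import Mathlib

open scoped ENNReal NNReal

namespace RelayPlacement

/-- The one-hop cost between the locations `(0,0)` and `(x,y)`: the hop cost `d` evaluated at the
Euclidean distance. -/
noncomputable def planarCost (d : ℝ → ℝ) (x y : ℝ) : ℝ := d (Real.sqrt (x ^ 2 + y ^ 2))

/-- The conditions on the one-hop cost `d : [0,∞) → ℝ` (values of `d` at negative reals are
irrelevant). -/
structure IsHopCost (d : ℝ → ℝ) : Prop where
  /-- A hop of length zero has a positive cost. -/
  zero_pos : 0 < d 0
  /-- The cost is convex in the distance ... -/
  convex : ConvexOn ℝ (Set.Ici 0) d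
  /-- ... and increasing (nothing more than non-decreasing is required). -/
  mono : MonotoneOn d (Set.Ici 0)
  /-- For every `δ > 0`, the increment `d (r + δ) - d r` tends to infinity with `r`
  (monotonicity of the increment is a consequence of convexity). -/
  increment_tendsto : ∀ δ : ℝ, 0 < δ →
    Filter.Tendsto (fun r : ℝ => d (r + δ) - d r) Filter.atTop Filter.atTop
  /-- On the open quadrant the planar cost is positive ... -/
  planar_pos : ∀ x y : ℝ, 0 < x → 0 < y → 0 < planarCost d x y
  /-- ... twice continuously differentiable ... -/
  planar_contDiff : ContDiffOn ℝ 2 (fun z : ℝ × ℝ => planarCost d z.1 z.2)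
    (Set.Ioi 0 ×ˢ Set.Ioi 0)
  /-- ... with `∂²d/∂x² > 0`, ... -/
  planar_xx : ∀ x y : ℝ, 0 < x → 0 < y →
    0 < deriv (fun s => deriv (fun s' => planarCost d s' y) s) x
  /-- ... `∂²d/∂x∂y ≥ 0` (it vanishes identically for `d r = a + b * r ^ 2`) ... -/
  planar_xy : ∀ x y : ℝ, 0 < x → 0 < y →
    0 ≤ deriv (fun s => deriv (fun t => planarCost d s t) y) x
  /-- ... and `∂²d/∂y² > 0`. -/
  planar_yy : ∀ x y : ℝ, 0 < x → 0 < y →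
    0 < deriv (fun t => deriv (fun t' => planarCost d x t') t) y

/-! ### The random path, trajectories and policies -/

/-- The two directions in which the path may proceed. -/
inductive Dir
  | east
  | north

/-- The lattice point reached from a lattice point by one step. -/
def move (s : ℕ × ℕ) : Dir → ℕ × ℕ
  | Dir.east => (s.1 + 1, s.2)
  | Dir.north => (s.1, s.2 + 1)

/-- A step is Eastward with probability `q` and Northward with probability `1 - q`. -/
noncomputable def dirProb (q : ℝ) : Dir → ℝ≥0∞
  | Dir.east => ENNReal.ofReal q
  | Dir.north => ENNReal.ofReal (1 - q)

/-- The law of the number of steps of the path: the path always continues for one more step, and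
that step is the last one with probability `p`. -/
noncomputable def lengthProb (p : ℝ) : ℕ → ℝ≥0∞
  | 0 => 0
  | k + 1 => ENNReal.ofReal (p * (1 - p) ^ k)

/-- A finite record `(u₀, a₁), (u₁, a₂), …` of the deployment: `u_k` is the action taken after `k`
steps (`true` : place a relay, `false` : do not place), `a_{k+1}` is the direction of the next
step. -/
abbrev Record := List (Bool × Dir)

/-- A (randomized, history-dependent) deployment policy: given everything observed before the
`k`-th decision, a probability distribution on the two actions. -/
abbrev Policy := Record → PMF Bool

/-- The probability that the actions and directions recorded in the second argument occur, given
that `past` has occurred and that the path is long enough. -/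
noncomputable def recordProb (q : ℝ) (π : Policy) : (past : Record) → Record → ℝ≥0∞
  | _, [] => 1
  | past, (u, a) :: ω => π past u * dirProb q a * recordProb q π (past ++ [(u, a)]) ω

/-- The probability, under the policy `π`, that `ω` is the complete record of the deployment, i.e.
that the path has exactly as many steps as `ω` and that `ω` records its directions and the actions
taken. -/
noncomputable def trajProb (p q : ℝ) (π : Policy) (ω : Record) : ℝ≥0∞ :=
  lengthProb p ω.length * recordProb q π [] ω

/-! ### Costs -/

/-- The total hop cost `C = ∑ d(r_i)` of a complete record, when the deployment person is initially
at displacement `s` from the previous relay (or from the control centre): a hop is completed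
whenever a relay is placed, and the last hop is completed by the source at the end of the path. -/
noncomputable def hopCostSum (d : ℝ → ℝ) : ℕ × ℕ → Record → ℝ≥0∞
  | s, [] => ENNReal.ofReal (planarCost d s.1 s.2)
  | s, (true, a) :: ω =>
      ENNReal.ofReal (planarCost d s.1 s.2) + hopCostSum d (move (0, 0) a) ω
  | s, (false, a) :: ω => hopCostSum d (move s a) ω

/-- The number `N` of relays placed. -/
def relayCount (ω : Record) : ℕ := ω.countP (fun x => x.1)

/-- The expected total hop cost `𝔼_π C`, starting from displacement `s`. -/
noncomputable def expectedHopCost (d : ℝ → ℝ) (p q : ℝ) (π : Policy) (s : ℕ × ℕ) : ℝ≥0∞ :=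
  ∑' ω : Record, trajProb p q π ω * hopCostSum d s ω

/-- The expected number of relays `𝔼_π N`. -/
noncomputable def expectedRelays (p q : ℝ) (π : Policy) : ℝ≥0∞ :=
  ∑' ω : Record, trajProb p q π ω * (relayCount ω : ℝ≥0∞)

/-- The cost-to-go `𝔼_π C + lam * 𝔼_π N` of the policy `π`, starting from displacement `s` on a
path that has not ended. -/
noncomputable def costToGo (d : ℝ → ℝ) (p q lam : ℝ) (π : Policy) (s : ℕ × ℕ) : ℝ≥0∞ :=
  expectedHopCost d p q π s + ENNReal.ofReal lam * expectedRelays p q π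

/-- The optimal cost-to-go `J_lam(m,n)`, `s = (m,n)`: the infimum over all policies. -/
noncomputable def optimalCostToGo (d : ℝ → ℝ) (p q lam : ℝ) (s : ℕ × ℕ) : ℝ≥0∞ :=
  ⨅ π : Policy, costToGo d p q lam π s

/-! ### Placement sets -/

/-- The displacement from the last relay at the end of a record that starts at displacement `s`. -/
def displacement : ℕ × ℕ → Record → ℕ × ℕ
  | s, [] => s
  | _, (true, a) :: ω => displacement (move (0, 0) a) ω
  | s, (false, a) :: ω => displacement (move s a) ω

open Classical in
/-- The stationary policy, for a deployment starting at displacement `s`, that places a relay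
exactly when the displacement from the last relay lies in `P`. -/
noncomputable def placementPolicy (P : Set (ℕ × ℕ)) (s : ℕ × ℕ) : Policy :=
  fun past => PMF.pure (decide (displacement s past ∈ P))

/-- `Δ₁(m,n) = d(m+1,n) - d(m,n)`. -/
noncomputable def delta₁ (d : ℝ → ℝ) (s : ℕ × ℕ) : ℝ :=
  planarCost d (s.1 + 1) s.2 - planarCost d s.1 s.2

/-- `Δ₂(m,n) = d(m,n+1) - d(m,n)`. -/
noncomputable def delta₂ (d : ℝ → ℝ) (s : ℕ × ℕ) : ℝ :=
  planarCost d s.1 (s.2 + 1) - planarCost d s.1 s.2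

/-- `Δ_q = q Δ₁ + (1 - q) Δ₂`. -/
noncomputable def deltaQ (d : ℝ → ℝ) (q : ℝ) (s : ℕ × ℕ) : ℝ :=
  q * delta₁ d s + (1 - q) * delta₂ d s

/-- The placement set `𝒫(h) = {(m,n) : p (lam + h) ≤ Δ_q(m,n)}`. -/
def placementSet (d : ℝ → ℝ) (p q lam h : ℝ) : Set (ℕ × ℕ) :=
  {s | p * (lam + h) ≤ deltaQ d q s}

/-- `g(h)`: the cost-to-go, starting from `(0,0)`, if the placement set `𝒫(h)` is employed. -/
noncomputable def g (d : ℝ → ℝ) (p q lam : ℝ) (h : ℝ≥0) : ℝ≥0∞ :=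
  costToGo d p q lam (placementPolicy (placementSet d p q lam h) (0, 0)) (0, 0)

end RelayPlacement

/-!
The deployment renews itself whenever a relay is placed, so the only unknown is the value `h` of
what follows a relay. Suppose that value is simply charged, i.e. that placing a relay at
displacement `s` costs `lam + h + d(s)` once and for all; then a single hop becomes an optimal
stopping problem. Placing now and placing one step later differ in cost by `p (lam + h) - Δ_q(s)`.
Convexity of `d` and `∂²d/∂x∂y ≥ 0` make `Δ_q` non-decreasing along the path
(`IsHopCost.deltaQ_le_move`), so once looking one step ahead favours placing, it does so forever:
the one-step-look-ahead rule `𝒫(h)` is optimal in the stopping problem. Its value is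
`d(s) + (lam + h)` minus the discounted sum of the positive parts of `p (lam + h) - Δ_q` along the
path (`stoppingValue`).

Let `F(h)` be the value of this problem from the origin (`firstHopValue` at `lam + h`). It is
non-decreasing in `h` with slope at most `1 - p`, since a relay is placed before the end of the
path with probability at most `1 - p`. So `F` is a contraction and has a unique fixed point `g*`.

The value of the stopping problem is compared with actual costs through the one-step recursion
`costToGo_recursion`.
* If `F(h) ≤ h`, the charge `h` overestimates the future, the value is a supersolution of the cost
  equation of the policy `𝒫(h)`, and `g(h) ≤ F(h)` (`g_le_firstHopValue`). Adding a constant to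
  the value gives a supersolution for every `h`, so `g` is finite (`g_ne_top`).
* At `h = g*` the charge is exact and the value is a subsolution of the optimality equation. It
  exceeds `d` by a bounded amount, and every policy costs at least `d(s)` from `s`, so that its
  excess over the cost of any policy is bounded; one step of the path contracts this excess by
  `1 - p`, and therefore it is not positive (`le_costToGo_of_subsolution`).

Hence `g* ≤ J_lam(0,0) ≤ g(g*) ≤ F(g*) = g*`. For `h > g*` the contraction yields
`g(h) ≤ F(h) < h`, and for `h < g*` optimality yields `g(h) ≥ g* > h`, so `g` has no other fixed
point.
-/

namespace RelayPlacement

/-! ### The planar cost -/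

variable {d : ℝ → ℝ}

theorem IsHopCost.continuousOn (hd : IsHopCost d) : ContinuousOn d (Set.Ici 0) := by
  intro r hr
  rcases eq_or_lt_of_le (Set.mem_Ici.1 hr) with rfl | hr
  -- near `0`, monotonicity bounds `d` from below and the chord over `[0, 1]` from above
  · have hup : Filter.Tendsto (fun r : ℝ => (1 - r) * d 0 + r * d 1)
        (nhdsWithin 0 (Set.Ici 0)) (nhds (d 0)) := by
      have : Continuous fun r : ℝ => (1 - r) * d 0 + r * d 1 := by fun_prop
      simpa using (this.tendsto 0).mono_left nhdsWithin_le_nhds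
    refine tendsto_of_tendsto_of_tendsto_of_le_of_le' tendsto_const_nhds hup ?_ ?_
    · filter_upwards [self_mem_nhdsWithin] with r hr
      exact hd.mono (Set.mem_Ici.2 le_rfl) hr hr
    · filter_upwards [self_mem_nhdsWithin,
        nhdsWithin_le_nhds (Iic_mem_nhds (zero_lt_one' ℝ))] with r hr hr1
      have := hd.convex.2 (Set.mem_Ici.2 le_rfl) (Set.mem_Ici.2 zero_le_one)
        (sub_nonneg.2 hr1) hr (by ring)
      simpa using this
  · have hint : ContinuousOn d (Set.Ioi 0) := by
      simpa using hd.convex.continuousOn_interior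
    exact (hint.continuousAt (Ioi_mem_nhds hr)).continuousWithinAt

theorem IsHopCost.continuous_planarCost (hd : IsHopCost d) :
    Continuous fun z : ℝ × ℝ => planarCost d z.1 z.2 :=
  hd.continuousOn.comp_continuous (by fun_prop) fun _ => Real.sqrt_nonneg _

theorem planarCost_comm (d : ℝ → ℝ) (x y : ℝ) : planarCost d x y = planarCost d y x := by
  simp only [planarCost, add_comm]

theorem IsHopCost.planarCost_pos (hd : IsHopCost d) (x y : ℝ) : 0 < planarCost d x y :=
  hd.zero_pos.trans_le
    (hd.mono (Set.mem_Ici.2 le_rfl) (Set.mem_Ici.2 (Real.sqrt_nonneg _)) (Real.sqrt_nonneg _))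

theorem IsHopCost.planarCost_le (hd : IsHopCost d) {x x' : ℝ} (y : ℝ) (hx : 0 ≤ x)
    (hxx' : x ≤ x') : planarCost d x y ≤ planarCost d x' y :=
  hd.mono (Set.mem_Ici.2 (Real.sqrt_nonneg _)) (Set.mem_Ici.2 (Real.sqrt_nonneg _)) <|
    Real.sqrt_le_sqrt (by gcongr)

/-- Second differences along a coordinate axis are nonnegative: the Euclidean distance is convex,
and `d` is convex and non-decreasing. -/
theorem IsHopCost.planarCost_second_difference (hd : IsHopCost d) (x y : ℝ) :
    planarCost d (x + 1) y - planarCost d x y ≤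
      planarCost d (x + 1 + 1) y - planarCost d (x + 1) y := by
  have htri : √((x + 1) ^ 2 + y ^ 2) ≤
      (1 / 2 : ℝ) * √(x ^ 2 + y ^ 2) + (1 / 2) * √((x + 1 + 1) ^ 2 + y ^ 2) := by
    have h := norm_add_le ((x : ℂ) + y * Complex.I) (((x + 1 + 1 : ℝ) : ℂ) + y * Complex.I)
    have h2 : ((x : ℂ) + y * Complex.I) + (((x + 1 + 1 : ℝ) : ℂ) + y * Complex.I)
        = (2 : ℝ) * (((x + 1 : ℝ) : ℂ) + y * Complex.I) := by
      push_cast; ring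
    rw [h2, norm_mul, Complex.norm_real, Complex.norm_add_mul_I, Complex.norm_add_mul_I,
      Complex.norm_add_mul_I] at h
    norm_num at h ⊢
    linarith
  have hmem : ∀ z : ℝ, √(z ^ 2 + y ^ 2) ∈ Set.Ici (0 : ℝ) := fun z => Real.sqrt_nonneg _
  have hconv := hd.convex.2 (hmem x) (hmem (x + 1 + 1)) (by norm_num : (0 : ℝ) ≤ 1 / 2)
    (by norm_num : (0 : ℝ) ≤ 1 / 2) (by norm_num)
  have hmono := hd.mono (hmem (x + 1)) (Set.mem_Ici.2 ((hmem (x + 1)).trans htri)) htri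
  simp only [smul_eq_mul] at hconv
  unfold planarCost
  linarith

/-- In the open quadrant, `∂²d/∂x∂y ≥ 0` makes the planar cost supermodular. -/
theorem IsHopCost.planarCost_supermodular_of_pos (hd : IsHopCost d) {x x' y y' : ℝ} (hx : 0 < x)
    (hxx' : x ≤ x') (hy : 0 < y) (hyy' : y ≤ y') :
    planarCost d x' y - planarCost d x y ≤ planarCost d x' y' - planarCost d x y' := by
  set Φ : ℝ × ℝ → ℝ := fun z => planarCost d z.1 z.2 with hΦ
  have hU : IsOpen (Set.Ioi (0 : ℝ) ×ˢ Set.Ioi (0 : ℝ)) := isOpen_Ioi.prod isOpen_Ioi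
  have hpartial : ∀ s t : ℝ, 0 < s → 0 < t →
      HasDerivAt (fun t' => planarCost d s t') (fderiv ℝ Φ (s, t) (0, 1)) t := by
    intro s t hs ht
    have h1 : HasFDerivAt Φ (fderiv ℝ Φ (s, t)) (s, t) :=
      ((hd.planar_contDiff.differentiableOn (by norm_num)).differentiableAt
        (hU.mem_nhds (Set.mk_mem_prod hs ht))).hasFDerivAt
    have h2 : HasDerivAt (fun t' : ℝ => (s, t')) ((0 : ℝ), (1 : ℝ)) t :=
      (hasDerivAt_const t s).prodMk (hasDerivAt_id t)
    exact h1.comp_hasDerivAt t h2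
  have hC1 : DifferentiableOn ℝ (fderiv ℝ Φ) (Set.Ioi (0 : ℝ) ×ˢ Set.Ioi (0 : ℝ)) :=
    (hd.planar_contDiff.fderiv_of_isOpen hU (m := 1) (by norm_num)).differentiableOn (by norm_num)
  have hmono : ∀ t : ℝ, 0 < t →
      MonotoneOn (fun s => deriv (fun t' => planarCost d s t') t) (Set.Ioi 0) := by
    intro t ht
    have hdiff : DifferentiableOn ℝ (fun s => deriv (fun t' => planarCost d s t') t)
        (Set.Ioi 0) := by
      have h1 : DifferentiableOn ℝ (fun s : ℝ => fderiv ℝ Φ (s, t) (0, 1)) (Set.Ioi 0) := by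
        have h2 : DifferentiableOn ℝ (fun s : ℝ => fderiv ℝ Φ (s, t)) (Set.Ioi 0) :=
          hC1.comp (f := fun s : ℝ => (s, t)) (by fun_prop) fun s hs => ⟨hs, ht⟩
        exact h2.clm_apply (differentiableOn_const _)
      exact h1.congr fun s hs => (hpartial s t hs ht).deriv
    refine monotoneOn_of_deriv_nonneg (convex_Ioi 0) hdiff.continuousOn
      (by simpa using hdiff) ?_
    intro s hs
    exact hd.planar_xy s t (by simpa using hs) ht
  have hx' : 0 < x' := hx.trans_le hxx'
  have hderiv : ∀ t : ℝ, 0 < t → HasDerivAt (fun t' => planarCost d x' t' - planarCost d x t')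
      (deriv (fun t' => planarCost d x' t') t - deriv (fun t' => planarCost d x t') t) t := by
    intro t ht
    rw [(hpartial x' t hx' ht).deriv, (hpartial x t hx ht).deriv]
    exact (hpartial x' t hx' ht).sub (hpartial x t hx ht)
  have hdiff : DifferentiableOn ℝ (fun t' => planarCost d x' t' - planarCost d x t')
      (Set.Ioi 0) := fun t ht => (hderiv t ht).differentiableAt.differentiableWithinAt
  refine monotoneOn_of_deriv_nonneg (convex_Ioi 0) hdiff.continuousOn (by simpa using hdiff) ?_
    hy (hy.trans_le hyy') hyy'
  intro t ht
  have ht' : 0 < t := by simpa using ht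
  rw [(hderiv t ht').deriv]
  exact sub_nonneg.2 (hmono t ht' hx hx' hxx')

/-- Supermodularity extends to the closed quadrant by continuity; the coordinate axes matter
because deployments start there. -/
theorem IsHopCost.planarCost_supermodular (hd : IsHopCost d) {x x' y y' : ℝ} (hx : 0 ≤ x)
    (hxx' : x ≤ x') (hy : 0 ≤ y) (hyy' : y ≤ y') :
    planarCost d x' y - planarCost d x y ≤ planarCost d x' y' - planarCost d x y' := by
  have hlim : ∀ a b : ℝ, Filter.Tendsto (fun ε : ℝ => planarCost d (a + ε) (b + ε))
      (nhdsWithin 0 (Set.Ioi 0)) (nhds (planarCost d a b)) := by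
    intro a b
    have : Continuous fun ε : ℝ => planarCost d (a + ε) (b + ε) :=
      hd.continuous_planarCost.comp (f := fun ε : ℝ => (a + ε, b + ε)) (by fun_prop)
    simpa using (this.tendsto 0).mono_left nhdsWithin_le_nhds
  refine le_of_tendsto_of_tendsto ((hlim x' y).sub (hlim x y)) ((hlim x' y').sub (hlim x y')) ?_
  filter_upwards [self_mem_nhdsWithin] with ε hε
  have hε : 0 < ε := hε
  exact hd.planarCost_supermodular_of_pos (by linarith) (by linarith) (by linarith) (by linarith)

/-- The planar cost of a hop to a lattice point. -/
noncomputable def latticeCost (d : ℝ → ℝ) (s : ℕ × ℕ) : ℝ := planarCost d s.1 s.2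

theorem IsHopCost.latticeCost_pos (hd : IsHopCost d) (s : ℕ × ℕ) : 0 < latticeCost d s :=
  hd.planarCost_pos _ _

theorem IsHopCost.latticeCost_le_move (hd : IsHopCost d) (s : ℕ × ℕ) (a : Dir) :
    latticeCost d s ≤ latticeCost d (move s a) := by
  cases a
  · exact hd.planarCost_le _ (Nat.cast_nonneg _) (by simp [move])
  · rw [latticeCost, latticeCost, planarCost_comm, planarCost_comm d (move s Dir.north).1]
    exact hd.planarCost_le _ (Nat.cast_nonneg _) (by simp [move])

theorem IsHopCost.deltaQ_nonneg (hd : IsHopCost d) {q : ℝ} (hq0 : 0 ≤ q) (hq1 : q ≤ 1)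
    (s : ℕ × ℕ) : 0 ≤ deltaQ d q s := by
  have h1 := hd.latticeCost_le_move s Dir.east
  have h2 := hd.latticeCost_le_move s Dir.north
  simp only [latticeCost, move, Nat.cast_add, Nat.cast_one] at h1 h2
  exact add_nonneg (mul_nonneg hq0 (sub_nonneg.2 h1))
    (mul_nonneg (sub_nonneg.2 hq1) (sub_nonneg.2 h2))

/-- Along the path, the expected one-step increment of the hop cost is non-decreasing. Hence a
placement set, once entered, is not left before a relay is placed. -/
theorem IsHopCost.deltaQ_le_move (hd : IsHopCost d) {q : ℝ} (hq0 : 0 ≤ q) (hq1 : q ≤ 1)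
    (s : ℕ × ℕ) (a : Dir) : deltaQ d q s ≤ deltaQ d q (move s a) := by
  obtain ⟨m, n⟩ := s
  have hm : (0 : ℝ) ≤ m := Nat.cast_nonneg _
  have hn : (0 : ℝ) ≤ n := Nat.cast_nonneg _
  have hq1' : 0 ≤ 1 - q := sub_nonneg.2 hq1
  have hsuper := hd.planarCost_supermodular hm (le_add_of_nonneg_right zero_le_one)
    hn (le_add_of_nonneg_right zero_le_one)
  cases a <;> simp only [deltaQ, delta₁, delta₂, move, Nat.cast_add, Nat.cast_one]
  · have h := hd.planarCost_second_difference m n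
    gcongr ?_ + ?_
    · exact mul_le_mul_of_nonneg_left h hq0
    · exact mul_le_mul_of_nonneg_left (by linarith) hq1'
  · have h := hd.planarCost_second_difference n m
    simp only [planarCost_comm d _ (m : ℝ)] at h
    gcongr ?_ + ?_
    · exact mul_le_mul_of_nonneg_left (by linarith) hq0
    · exact mul_le_mul_of_nonneg_left h hq1'

/-! ### One-step recursion for the cost of a policy -/

theorem tsum_list {α : Type*} (f : List α → ℝ≥0∞) :
    ∑' l, f l = f [] + ∑' a, ∑' l, f (a :: l) := by
  let e : Unit ⊕ (α × List α) ≃ List α :=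
    { toFun := fun o => o.elim (fun _ => []) fun x => x.1 :: x.2
      invFun := fun l => match l with
        | [] => Sum.inl ()
        | a :: l => Sum.inr (a, l)
      left_inv := by rintro (_ | ⟨a, l⟩) <;> rfl
      right_inv := by rintro (_ | ⟨a, l⟩) <;> rfl }
  rw [← e.tsum_eq, Summable.tsum_sum ENNReal.summable ENNReal.summable, ← ENNReal.tsum_prod,
    tsum_fintype]
  simp [e]

instance : Fintype Dir := ⟨⟨{Dir.east, Dir.north}, by simp⟩, by rintro (_ | _) <;> simp⟩

theorem sum_dir {M : Type*} [AddCommMonoid M] (f : Dir → M) :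
    ∑ a, f a = f Dir.east + f Dir.north := by
  change ((({Dir.east, Dir.north} : Multiset Dir).map f).sum) = _
  simp

theorem sum_dirProb {q : ℝ} (hq0 : 0 ≤ q) (hq1 : q ≤ 1) : ∑ a, dirProb q a = 1 := by
  rw [sum_dir, dirProb, dirProb, ← ENNReal.ofReal_add hq0 (sub_nonneg.2 hq1)]
  simp

theorem sum_policy (π : Policy) (past : Record) : ∑ u, π past u = 1 := by
  rw [← tsum_fintype (L := .unconditional _)]
  exact (π past).tsum_coe

/-- The policy that remains to be followed after the action and the direction `x`. -/
def Policy.after (π : Policy) (x : Bool × Dir) : Policy := fun past => π (x :: past)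

theorem recordProb_cons_past (q : ℝ) (π : Policy) (x : Bool × Dir) (past ω : Record) :
    recordProb q π (x :: past) ω = recordProb q (π.after x) past ω := by
  induction ω generalizing past with
  | nil => rfl
  | cons y ω ih =>
    rw [recordProb, recordProb, ← ih]
    rfl

theorem recordProb_cons (q : ℝ) (π : Policy) (x : Bool × Dir) (ω : Record) :
    recordProb q π [] (x :: ω) =
      π [] x.1 * dirProb q x.2 * recordProb q (π.after x) [] ω := by
  rw [recordProb, ← recordProb_cons_past]
  rfl

theorem tsum_recordProb_length_eq {q : ℝ} (hq0 : 0 ≤ q) (hq1 : q ≤ 1) (k : ℕ) (π : Policy) :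
    ∑' ω : Record, (if k = ω.length then 1 else 0) * recordProb q π [] ω = 1 := by
  induction k generalizing π with
  | zero => rw [tsum_list]; simp [recordProb]
  | succ k ih =>
    rw [tsum_list]
    simp only [List.length_nil, Nat.add_one_ne_zero, if_false, zero_mul, zero_add,
      List.length_cons, Nat.add_right_cancel_iff, recordProb_cons, mul_left_comm _ (_ * _),
      ENNReal.tsum_mul_left, ih, mul_one]
    rw [ENNReal.tsum_prod', tsum_fintype]
    simp only [tsum_fintype, ← Finset.mul_sum, sum_dirProb hq0 hq1, mul_one, sum_policy]

/-- Given the number of steps, the records of that length have total probability one. -/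
theorem tsum_length_mul_recordProb {q : ℝ} (hq0 : 0 ≤ q) (hq1 : q ≤ 1) (ℓ : ℕ → ℝ≥0∞)
    (π : Policy) : ∑' ω : Record, ℓ ω.length * recordProb q π [] ω = ∑' k, ℓ k := by
  calc ∑' ω : Record, ℓ ω.length * recordProb q π [] ω
      = ∑' (ω : Record) (k : ℕ), ℓ k * ((if k = ω.length then 1 else 0) *
          recordProb q π [] ω) := by
        refine tsum_congr fun ω => ?_
        rw [tsum_eq_single ω.length (by intro k hk; simp [hk])]
        simp
    _ = ∑' k, ℓ k := by
        rw [ENNReal.tsum_comm]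
        simp only [ENNReal.tsum_mul_left, tsum_recordProb_length_eq hq0 hq1, mul_one]

theorem lengthProb_succ {p : ℝ} (hp1 : p ≤ 1) (k : ℕ) :
    lengthProb p (k + 1) =
      ENNReal.ofReal p * (if k = 0 then 1 else 0) + ENNReal.ofReal (1 - p) * lengthProb p k := by
  cases k with
  | zero => simp [lengthProb]
  | succ k =>
    simp only [lengthProb, Nat.add_one_ne_zero, if_false, mul_zero, zero_add]
    rw [← ENNReal.ofReal_mul (sub_nonneg.2 hp1)]
    ring_nf

theorem tsum_lengthProb {p : ℝ} (hp0 : 0 < p) (hp1 : p ≤ 1) : ∑' k, lengthProb p k = 1 := by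
  have hp1' : 0 ≤ 1 - p := sub_nonneg.2 hp1
  have hsum : HasSum (fun k : ℕ => p * (1 - p) ^ k) 1 := by
    simpa [hp0.ne'] using (hasSum_geometric_of_lt_one hp1' (by linarith)).mul_left p
  rw [tsum_eq_zero_add' ENNReal.summable]
  simp only [lengthProb, zero_add]
  rw [← ENNReal.ofReal_tsum_of_nonneg (fun k => by positivity) hsum.summable, hsum.tsum_eq,
    ENNReal.ofReal_one]

/-- The displacement from which the next step departs after the action `u` at displacement `s`. -/
def base (u : Bool) (s : ℕ × ℕ) : ℕ × ℕ := if u then (0, 0) else s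

/-- The cost that is incurred at once by the action `u` at displacement `s`. -/
noncomputable def stageCost (d : ℝ → ℝ) (lam : ℝ) (u : Bool) (s : ℕ × ℕ) : ℝ≥0∞ :=
  if u then ENNReal.ofReal lam + ENNReal.ofReal (planarCost d s.1 s.2) else 0

/-- The hop costs plus `lam` times the number of relays of a complete record. -/
noncomputable def recordCost (d : ℝ → ℝ) (lam : ℝ) (s : ℕ × ℕ) (ω : Record) : ℝ≥0∞ :=
  hopCostSum d s ω + ENNReal.ofReal lam * (relayCount ω : ℝ≥0∞)

theorem recordCost_nil (d : ℝ → ℝ) (lam : ℝ) (s : ℕ × ℕ) :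
    recordCost d lam s [] = ENNReal.ofReal (planarCost d s.1 s.2) := by
  simp [recordCost, hopCostSum, relayCount]

theorem recordCost_cons (d : ℝ → ℝ) (lam : ℝ) (s : ℕ × ℕ) (x : Bool × Dir) (ω : Record) :
    recordCost d lam s (x :: ω) =
      stageCost d lam x.1 s + recordCost d lam (move (base x.1 s) x.2) ω := by
  obtain ⟨_ | _, a⟩ := x
  · simp [recordCost, hopCostSum, relayCount, stageCost, base]
  · simp only [recordCost, hopCostSum, relayCount, stageCost, base, List.countP_cons_of_pos,
      if_true, Nat.cast_add, Nat.cast_one]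
    ring

/-- The expected cost of a policy when `ℓ k` is the (possibly defective) probability that the path
has `k` steps. -/
noncomputable def weightedCost (d : ℝ → ℝ) (q lam : ℝ) (ℓ : ℕ → ℝ≥0∞) (π : Policy)
    (s : ℕ × ℕ) : ℝ≥0∞ :=
  ∑' ω : Record, ℓ ω.length * recordProb q π [] ω * recordCost d lam s ω

theorem costToGo_eq_weightedCost (d : ℝ → ℝ) (p q lam : ℝ) (π : Policy) (s : ℕ × ℕ) :
    costToGo d p q lam π s = weightedCost d q lam (lengthProb p) π s := by
  simp only [costToGo, expectedHopCost, expectedRelays, weightedCost, recordCost, trajProb]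
  rw [← ENNReal.tsum_mul_left, ← ENNReal.tsum_add]
  refine tsum_congr fun ω => ?_
  ring

theorem weightedCost_recursion (d : ℝ → ℝ) {q : ℝ} (hq0 : 0 ≤ q) (hq1 : q ≤ 1) (lam : ℝ)
    (ℓ : ℕ → ℝ≥0∞) (π : Policy) (s : ℕ × ℕ) :
    weightedCost d q lam ℓ π s = ℓ 0 * ENNReal.ofReal (planarCost d s.1 s.2) +
      ∑ u, π [] u * (stageCost d lam u s * (∑' k, ℓ (k + 1)) +
        ∑ a, dirProb q a *
          weightedCost d q lam (fun k => ℓ (k + 1)) (π.after (u, a)) (move (base u s) a)) := by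
  have hinner : ∀ x : Bool × Dir,
      ∑' ω : Record, ℓ (x :: ω).length * recordProb q π [] (x :: ω) *
          recordCost d lam s (x :: ω) =
        π [] x.1 * dirProb q x.2 * (stageCost d lam x.1 s * (∑' k, ℓ (k + 1)) +
          weightedCost d q lam (fun k => ℓ (k + 1)) (π.after x) (move (base x.1 s) x.2)) := by
    intro x
    rw [← tsum_length_mul_recordProb hq0 hq1 (fun k => ℓ (k + 1)) (π.after x), weightedCost,
      ← ENNReal.tsum_mul_left, ← ENNReal.tsum_add, ← ENNReal.tsum_mul_left]
    refine tsum_congr fun ω => ?_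
    rw [recordProb_cons, recordCost_cons, List.length_cons]
    ring
  rw [weightedCost, tsum_list]
  simp only [hinner]
  rw [recordCost_nil, ENNReal.tsum_prod', tsum_fintype]
  simp only [List.length_nil, recordProb, mul_one, tsum_fintype]
  congr 1
  refine Finset.sum_congr rfl fun u _ => ?_
  simp only [mul_add, Finset.sum_add_distrib, mul_assoc, ← Finset.mul_sum]
  rw [← Finset.sum_mul, sum_dirProb hq0 hq1, one_mul]

theorem weightedCost_zero_add (d : ℝ → ℝ) (q lam : ℝ) (a b : ℝ≥0∞) (ℓ : ℕ → ℝ≥0∞) (π : Policy)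
    (s : ℕ × ℕ) :
    weightedCost d q lam (fun k => a * (if k = 0 then 1 else 0) + b * ℓ k) π s =
      a * ENNReal.ofReal (planarCost d s.1 s.2) + b * weightedCost d q lam ℓ π s := by
  have h0 : ∑' ω : Record, (if ω.length = 0 then 1 else 0) * recordProb q π [] ω *
      recordCost d lam s ω = ENNReal.ofReal (planarCost d s.1 s.2) := by
    rw [tsum_list]
    simp [recordProb, recordCost_nil]
  simp only [weightedCost]
  rw [← h0, ← ENNReal.tsum_mul_left, ← ENNReal.tsum_mul_left, ← ENNReal.tsum_add]
  refine tsum_congr fun ω => ?_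
  ring

/-- The expected cost of what follows the decision: from the point `t` the path makes one step; if
it ends there, the source has to be connected, otherwise `X` is paid. -/
noncomputable def afterCost (d : ℝ → ℝ) (p q : ℝ) (X : Dir → ℝ≥0∞) (t : ℕ × ℕ) : ℝ≥0∞ :=
  ∑ a, dirProb q a * (ENNReal.ofReal p *
    ENNReal.ofReal (planarCost d (move t a).1 (move t a).2) + ENNReal.ofReal (1 - p) * X a)

theorem afterCost_mono (d : ℝ → ℝ) (p q : ℝ) {X Y : Dir → ℝ≥0∞} (h : ∀ a, X a ≤ Y a)
    (t : ℕ × ℕ) : afterCost d p q X t ≤ afterCost d p q Y t := by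
  unfold afterCost
  gcongr with a
  exact h a

theorem afterCost_add_const (d : ℝ → ℝ) (p : ℝ) {q : ℝ} (hq0 : 0 ≤ q) (hq1 : q ≤ 1)
    (X : Dir → ℝ≥0∞) (b : ℝ≥0∞) (t : ℕ × ℕ) :
    afterCost d p q (fun a => X a + b) t = afterCost d p q X t + ENNReal.ofReal (1 - p) * b := by
  simp only [afterCost, mul_add, ← add_assoc]
  rw [Finset.sum_add_distrib, ← Finset.sum_mul, sum_dirProb hq0 hq1, one_mul]

theorem costToGo_recursion (d : ℝ → ℝ) {p q : ℝ} (hp0 : 0 < p) (hp1 : p ≤ 1) (hq0 : 0 ≤ q)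
    (hq1 : q ≤ 1) (lam : ℝ) (π : Policy) (s : ℕ × ℕ) :
    costToGo d p q lam π s = ∑ u, π [] u * (stageCost d lam u s + afterCost d p q
      (fun a => costToGo d p q lam (π.after (u, a)) (move (base u s) a)) (base u s)) := by
  have h1 : ∑' k, lengthProb p (k + 1) = 1 := by
    have := tsum_lengthProb hp0 hp1
    rwa [tsum_eq_zero_add' ENNReal.summable, lengthProb, zero_add] at this
  simp only [costToGo_eq_weightedCost]
  rw [weightedCost_recursion d hq0 hq1]
  rw [h1, lengthProb, zero_mul, zero_add]
  simp only [lengthProb_succ hp1, weightedCost_zero_add, afterCost, mul_one]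

/-- The law of the number of steps, restricted to paths of at most `n` steps. -/
noncomputable def truncLengthProb (p : ℝ) (n k : ℕ) : ℝ≥0∞ := if k ≤ n then lengthProb p k else 0

theorem weightedCost_truncLengthProb_succ_le (d : ℝ → ℝ) {p q : ℝ} (hp0 : 0 < p) (hp1 : p ≤ 1)
    (hq0 : 0 ≤ q) (hq1 : q ≤ 1) (lam : ℝ) (n : ℕ) (π : Policy) (s : ℕ × ℕ) :
    weightedCost d q lam (truncLengthProb p (n + 1)) π s ≤
      ∑ u, π [] u * (stageCost d lam u s + afterCost d p q (fun a => weightedCost d q lam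
        (truncLengthProb p n) (π.after (u, a)) (move (base u s) a)) (base u s)) := by
  have h1 : ∑' k, truncLengthProb p (n + 1) (k + 1) ≤ 1 := by
    have := tsum_lengthProb hp0 hp1
    rw [tsum_eq_zero_add' ENNReal.summable, lengthProb, zero_add] at this
    rw [← this]
    refine ENNReal.tsum_le_tsum fun k => ?_
    unfold truncLengthProb
    split_ifs
    exacts [le_rfl, zero_le]
  have h2 : ∀ k, truncLengthProb p (n + 1) (k + 1) =
      ENNReal.ofReal p * (if k = 0 then 1 else 0) +
        ENNReal.ofReal (1 - p) * truncLengthProb p n k := by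
    intro k
    unfold truncLengthProb
    by_cases hk : k ≤ n
    · simp only [hk, Nat.add_le_add_iff_right, if_true, lengthProb_succ hp1]
    · have : k ≠ 0 := by omega
      simp [hk, this]
  rw [weightedCost_recursion d hq0 hq1]
  have h0 : truncLengthProb p (n + 1) 0 = 0 := by simp [truncLengthProb, lengthProb]
  rw [h0, zero_mul, zero_add]
  gcongr with u
  · exact mul_le_of_le_one_right' h1
  · simp only [h2, weightedCost_zero_add, afterCost]
    exact le_rfl

theorem costToGo_le_of_forall_truncLengthProb (d : ℝ → ℝ) (p q lam : ℝ) (π : Policy)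
    (s : ℕ × ℕ) {b : ℝ≥0∞}
    (h : ∀ n, weightedCost d q lam (truncLengthProb p n) π s ≤ b) :
    costToGo d p q lam π s ≤ b := by
  rw [costToGo_eq_weightedCost, weightedCost, ENNReal.tsum_eq_iSup_sum]
  refine iSup_le fun S => ?_
  refine le_trans ?_ ((ENNReal.sum_le_tsum S).trans (h (S.sup List.length)))
  refine le_of_eq (Finset.sum_congr rfl fun ω hω => ?_)
  rw [truncLengthProb, if_pos (Finset.le_sup (f := List.length) hω)]

/-! ### Verification by super- and subsolutions of the optimality equation -/

variable {p q : ℝ}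

/-- The expectation of `u` at the displacement after one more step from `s`. -/
noncomputable def meanNext (q : ℝ) (u : ℕ × ℕ → ℝ) (s : ℕ × ℕ) : ℝ :=
  q * u (move s Dir.east) + (1 - q) * u (move s Dir.north)

theorem meanNext_mono (hq0 : 0 ≤ q) (hq1 : q ≤ 1) {u v : ℕ × ℕ → ℝ} (h : ∀ s, u s ≤ v s)
    (s : ℕ × ℕ) : meanNext q u s ≤ meanNext q v s :=
  add_le_add (mul_le_mul_of_nonneg_left (h _) hq0)
    (mul_le_mul_of_nonneg_left (h _) (sub_nonneg.2 hq1))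

theorem meanNext_const (q b : ℝ) (s : ℕ × ℕ) : meanNext q (fun _ => b) s = b := by
  unfold meanNext; ring

theorem meanNext_add_const (q : ℝ) (u : ℕ × ℕ → ℝ) (b : ℝ) (s : ℕ × ℕ) :
    meanNext q (fun t => u t + b) s = meanNext q u s + b := by
  unfold meanNext; ring

theorem meanNext_latticeCost (d : ℝ → ℝ) (q : ℝ) (s : ℕ × ℕ) :
    meanNext q (latticeCost d) s = latticeCost d s + deltaQ d q s := by
  simp only [meanNext, latticeCost, deltaQ, delta₁, delta₂, move, Nat.cast_add, Nat.cast_one]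
  ring

/-- The expected cost of going on from `s` without placing a relay, if `v` is the cost-to-go after
one more step. -/
noncomputable def continuationCost (d : ℝ → ℝ) (p q : ℝ) (v : ℕ × ℕ → ℝ) (s : ℕ × ℕ) : ℝ :=
  meanNext q (fun t => p * latticeCost d t + (1 - p) * v t) s

theorem continuationCost_nonneg (hd : IsHopCost d) (hp0 : 0 ≤ p) (hp1 : p ≤ 1) (hq0 : 0 ≤ q)
    (hq1 : q ≤ 1) {v : ℕ × ℕ → ℝ} (hv : ∀ s, 0 ≤ v s) (s : ℕ × ℕ) :
    0 ≤ continuationCost d p q v s := by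
  rw [← meanNext_const q 0 s]
  exact meanNext_mono hq0 hq1 (fun t => add_nonneg (mul_nonneg hp0 (hd.latticeCost_pos t).le)
    (mul_nonneg (sub_nonneg.2 hp1) (hv t))) s

theorem continuationCost_add_const (d : ℝ → ℝ) (p q : ℝ) (v : ℕ × ℕ → ℝ) (b : ℝ) (s : ℕ × ℕ) :
    continuationCost d p q (fun t => v t + b) s = continuationCost d p q v s + (1 - p) * b := by
  unfold continuationCost meanNext; ring

theorem afterCost_ofReal (hd : IsHopCost d) (hp0 : 0 ≤ p) (hp1 : p ≤ 1) (hq0 : 0 ≤ q)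
    (hq1 : q ≤ 1) {v : ℕ × ℕ → ℝ} (hv : ∀ s, 0 ≤ v s) (s : ℕ × ℕ) :
    afterCost d p q (fun a => ENNReal.ofReal (v (move s a))) s =
      ENNReal.ofReal (continuationCost d p q v s) := by
  have hp1' : 0 ≤ 1 - p := sub_nonneg.2 hp1
  have hq1' : 0 ≤ 1 - q := sub_nonneg.2 hq1
  have hl : ∀ t, 0 ≤ latticeCost d t := fun t => (hd.latticeCost_pos t).le
  have hsum : ∀ t, 0 ≤ p * latticeCost d t + (1 - p) * v t := fun t =>
    add_nonneg (mul_nonneg hp0 (hl t)) (mul_nonneg hp1' (hv t))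
  rw [afterCost, sum_dir, dirProb, dirProb, continuationCost, meanNext,
    ENNReal.ofReal_add (mul_nonneg hq0 (hsum _)) (mul_nonneg hq1' (hsum _)),
    ENNReal.ofReal_mul hq0, ENNReal.ofReal_mul hq1',
    ENNReal.ofReal_add (mul_nonneg hp0 (hl _)) (mul_nonneg hp1' (hv _)),
    ENNReal.ofReal_add (mul_nonneg hp0 (hl _)) (mul_nonneg hp1' (hv _)),
    ENNReal.ofReal_mul hp0, ENNReal.ofReal_mul hp0, ENNReal.ofReal_mul hp1',
    ENNReal.ofReal_mul hp1']
  rfl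

theorem IsHopCost.latticeCost_le_recordCost (hd : IsHopCost d) (lam : ℝ) (s : ℕ × ℕ)
    (ω : Record) : ENNReal.ofReal (latticeCost d s) ≤ recordCost d lam s ω := by
  induction ω generalizing s with
  | nil => rw [recordCost_nil]; exact le_rfl
  | cons x ω ih =>
    rw [recordCost_cons]
    obtain ⟨_ | _, a⟩ := x
    · exact ((ENNReal.ofReal_le_ofReal (hd.latticeCost_le_move s a)).trans (ih _)).trans
        le_add_self
    · exact (le_add_self (b := ENNReal.ofReal lam)).trans
        (le_self_add (a := stageCost d lam true s))

/-- Whatever the policy, the hop that is under way at displacement `s` costs at least `d(s)`. -/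
theorem IsHopCost.latticeCost_le_costToGo (hd : IsHopCost d) (hp0 : 0 < p) (hp1 : p ≤ 1)
    (hq0 : 0 ≤ q) (hq1 : q ≤ 1) (lam : ℝ) (π : Policy) (s : ℕ × ℕ) :
    ENNReal.ofReal (latticeCost d s) ≤ costToGo d p q lam π s := by
  have h1 : ∑' ω : Record, lengthProb p ω.length * recordProb q π [] ω = 1 := by
    rw [tsum_length_mul_recordProb hq0 hq1, tsum_lengthProb hp0 hp1]
  rw [costToGo_eq_weightedCost, ← one_mul (ENNReal.ofReal _), ← h1, ← ENNReal.tsum_mul_right]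
  exact ENNReal.tsum_le_tsum fun ω => by gcongr; exact hd.latticeCost_le_recordCost lam s ω

/-- A subsolution `v` of the optimality equation is a lower bound for the cost of every policy,
provided that `v - d` is bounded above. Every policy costs at least `d`, so `v` exceeds its cost by
a bounded amount at most, and each step contracts this excess by the factor `1 - p`. -/
theorem le_costToGo_of_subsolution (hd : IsHopCost d) (hp0 : 0 < p) (hp1 : p ≤ 1) (hq0 : 0 ≤ q)
    (hq1 : q ≤ 1) {lam : ℝ} (hlam : 0 ≤ lam) {v : ℕ × ℕ → ℝ} (hv : ∀ s, 0 ≤ v s) {c : ℝ}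
    (hc : 0 ≤ c) (hvc : ∀ s, v s ≤ latticeCost d s + c)
    (hplace : ∀ s, v s ≤ lam + latticeCost d s + continuationCost d p q v (0, 0))
    (hcont : ∀ s, v s ≤ continuationCost d p q v s) (π : Policy) (s : ℕ × ℕ) :
    ENNReal.ofReal (v s) ≤ costToGo d p q lam π s := by
  have hp1' : 0 ≤ 1 - p := sub_nonneg.2 hp1
  have key : ∀ (n : ℕ) (π : Policy) (s : ℕ × ℕ),
      ENNReal.ofReal (v s) ≤ costToGo d p q lam π s + ENNReal.ofReal ((1 - p) ^ n * c) := by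
    intro n
    induction n with
    | zero =>
      intro π s
      rw [pow_zero, one_mul]
      refine (ENNReal.ofReal_le_ofReal (hvc s)).trans ?_
      rw [ENNReal.ofReal_add (hd.latticeCost_pos s).le hc]
      gcongr
      exact hd.latticeCost_le_costToGo hp0 hp1 hq0 hq1 lam π s
    | succ n ih =>
      intro π s
      have hact : ∀ u, ENNReal.ofReal (v s) ≤ stageCost d lam u s + afterCost d p q
          (fun a => costToGo d p q lam (π.after (u, a)) (move (base u s) a)) (base u s) +
          ENNReal.ofReal ((1 - p) ^ (n + 1) * c) := by
        intro u
        have hstep : ENNReal.ofReal (continuationCost d p q v (base u s)) ≤ afterCost d p q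
            (fun a => costToGo d p q lam (π.after (u, a)) (move (base u s) a)) (base u s) +
            ENNReal.ofReal ((1 - p) ^ (n + 1) * c) := by
          rw [← afterCost_ofReal hd hp0.le hp1 hq0 hq1 hv, pow_succ', mul_assoc,
            ENNReal.ofReal_mul hp1', ← afterCost_add_const d p hq0 hq1]
          exact afterCost_mono d p q (fun a => ih _ _) _
        rw [add_assoc]
        refine le_trans ?_ (add_le_add_right hstep _)
        cases u
        · exact (ENNReal.ofReal_le_ofReal (hcont s)).trans le_add_self
        · refine (ENNReal.ofReal_le_ofReal (hplace s)).trans (le_of_eq ?_)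
          have hl := (hd.latticeCost_pos s).le
          rw [ENNReal.ofReal_add (add_nonneg hlam hl)
            (continuationCost_nonneg hd hp0.le hp1 hq0 hq1 hv _), ENNReal.ofReal_add hlam hl]
          rfl
      rw [costToGo_recursion d hp0 hp1 hq0 hq1, ← one_mul (ENNReal.ofReal (v s)),
        ← one_mul (ENNReal.ofReal (_ * c)), ← sum_policy π [], Finset.sum_mul, Finset.sum_mul,
        ← Finset.sum_add_distrib]
      refine Finset.sum_le_sum fun u _ => ?_
      rw [← mul_add]
      gcongr
      exact hact u
  have hlim : Filter.Tendsto
      (fun n : ℕ => costToGo d p q lam π s + ENNReal.ofReal ((1 - p) ^ n * c))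
      Filter.atTop (nhds (costToGo d p q lam π s)) := by
    have h := (tendsto_pow_atTop_nhds_zero_of_lt_one hp1' (by linarith)).mul_const c
    have h' := (ENNReal.tendsto_ofReal h).const_add (costToGo d p q lam π s)
    simpa using h'
  exact ge_of_tendsto' hlim fun n => key n π s

theorem placementPolicy_after (P : Set (ℕ × ℕ)) (s : ℕ × ℕ) (u : Bool) (a : Dir) :
    (placementPolicy P s).after (u, a) = placementPolicy P (move (base u s) a) := by
  cases u <;> rfl

/-- A nonnegative supersolution of the cost equation of a placement set is an upper bound for the
cost of the corresponding stationary policy. -/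
theorem costToGo_placementPolicy_le_of_supersolution (hd : IsHopCost d) (hp0 : 0 < p)
    (hp1 : p ≤ 1) (hq0 : 0 ≤ q) (hq1 : q ≤ 1) {lam : ℝ} (hlam : 0 ≤ lam) (P : Set (ℕ × ℕ))
    {v : ℕ × ℕ → ℝ} (hv : ∀ s, 0 ≤ v s)
    (hplace : ∀ s ∈ P, lam + latticeCost d s + continuationCost d p q v (0, 0) ≤ v s)
    (hcont : ∀ s ∉ P, continuationCost d p q v s ≤ v s) (s : ℕ × ℕ) :
    costToGo d p q lam (placementPolicy P s) s ≤ ENNReal.ofReal (v s) := by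
  refine costToGo_le_of_forall_truncLengthProb d p q lam _ s fun n => ?_
  induction n generalizing s with
  | zero =>
    refine le_trans (le_of_eq ?_) zero_le
    refine ENNReal.tsum_eq_zero.2 fun ω => ?_
    rcases ω with _ | ⟨x, ω⟩ <;> simp [truncLengthProb, lengthProb]
  | succ n ih =>
    refine (weightedCost_truncLengthProb_succ_le d hp0 hp1 hq0 hq1 lam n _ s).trans ?_
    have hact : ∀ u, afterCost d p q (fun a => weightedCost d q lam (truncLengthProb p n)
        ((placementPolicy P s).after (u, a)) (move (base u s) a)) (base u s) ≤
        ENNReal.ofReal (continuationCost d p q v (base u s)) := by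
      intro u
      rw [← afterCost_ofReal hd hp0.le hp1 hq0 hq1 hv]
      refine afterCost_mono d p q (fun a => ?_) _
      rw [placementPolicy_after]
      exact ih _
    by_cases hs : s ∈ P
    · have hpol : ∀ u, placementPolicy P s [] u = if u = true then 1 else 0 := by
        intro u
        simp [placementPolicy, displacement, hs, PMF.pure_apply]
      simp only [hpol, Fintype.sum_bool, if_true, one_mul, Bool.false_eq_true, if_false, zero_mul,
        add_zero]
      refine (add_le_add_right (hact true) _).trans
        (le_trans (le_of_eq ?_) (ENNReal.ofReal_le_ofReal (hplace s hs)))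
      have hl := (hd.latticeCost_pos s).le
      rw [ENNReal.ofReal_add (add_nonneg hlam hl)
        (continuationCost_nonneg hd hp0.le hp1 hq0 hq1 hv _), ENNReal.ofReal_add hlam hl]
      rfl
    · have hpol : ∀ u, placementPolicy P s [] u = if u = true then 0 else 1 := by
        intro u
        cases u <;> simp [placementPolicy, displacement, hs, PMF.pure_apply]
      simp only [hpol, Fintype.sum_bool, if_true, one_mul, Bool.false_eq_true, if_false, zero_mul,
        zero_add]
      refine (add_le_add_right (hact false) _).trans
        (le_trans (le_of_eq ?_) (ENNReal.ofReal_le_ofReal (hcont s hs)))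
      simp [stageCost, base]

/-! ### The stopping problem for a single hop -/

/-- The expected saving of one further step without a relay over an immediate placement, where it
is positive: at displacement `s`, an immediate placement costs `c + d(s)` altogether, and making
one more step and then placing, unless the path has ended, costs `c + d(s) - (p * c - Δ_q(s))` in
expectation. -/
noncomputable def stepSaving (d : ℝ → ℝ) (p q c : ℝ) (s : ℕ × ℕ) : ℝ :=
  max 0 (p * c - deltaQ d q s)

/-- The expected saving of the optimal continuation over an immediate placement, in the problem of
ending a single hop when a placement costs `c` in addition to the hop cost: the step savings along
the path, discounted by the probability that the path has not ended. Since `Δ_q` does not decrease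
along the path, the step savings vanish from the first visit to the placement set on. -/
noncomputable def totalSaving (d : ℝ → ℝ) (p q c : ℝ) (s : ℕ × ℕ) : ℝ :=
  ∑' k : ℕ, (1 - p) ^ k * (meanNext q)^[k] (stepSaving d p q c) s

/-- The optimal cost, from displacement `s`, in the problem of ending a single hop when a placement
costs `c` in addition to the hop cost. -/
noncomputable def stoppingValue (d : ℝ → ℝ) (p q c : ℝ) (s : ℕ × ℕ) : ℝ :=
  latticeCost d s + c - totalSaving d p q c s

theorem iterate_meanNext_nonneg (hq0 : 0 ≤ q) (hq1 : q ≤ 1) {u : ℕ × ℕ → ℝ}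
    (hu : ∀ s, 0 ≤ u s) (k : ℕ) (s : ℕ × ℕ) : 0 ≤ (meanNext q)^[k] u s := by
  induction k generalizing s with
  | zero => exact hu s
  | succ k ih =>
    rw [Function.iterate_succ_apply', ← meanNext_const q 0 s]
    exact meanNext_mono hq0 hq1 ih s

theorem iterate_meanNext_le_add (hq0 : 0 ≤ q) (hq1 : q ≤ 1) {u v : ℕ × ℕ → ℝ} {b : ℝ}
    (h : ∀ s, u s ≤ v s + b) (k : ℕ) (s : ℕ × ℕ) :
    (meanNext q)^[k] u s ≤ (meanNext q)^[k] v s + b := by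
  induction k generalizing s with
  | zero => exact h s
  | succ k ih =>
    rw [Function.iterate_succ_apply', Function.iterate_succ_apply', ← meanNext_add_const]
    exact meanNext_mono hq0 hq1 ih s

theorem stepSaving_mono (d : ℝ → ℝ) (hp0 : 0 ≤ p) (q : ℝ) {c c' : ℝ} (h : c ≤ c')
    (s : ℕ × ℕ) : stepSaving d p q c s ≤ stepSaving d p q c' s := by
  unfold stepSaving; gcongr

theorem stepSaving_le_add (d : ℝ → ℝ) (hp0 : 0 ≤ p) (q : ℝ) {c c' : ℝ} (h : c ≤ c')
    (s : ℕ × ℕ) : stepSaving d p q c' s ≤ stepSaving d p q c s + p * (c' - c) := by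
  have h' : 0 ≤ p * (c' - c) := mul_nonneg hp0 (sub_nonneg.2 h)
  unfold stepSaving
  refine max_le (add_nonneg (le_max_left _ _) h') ?_
  have := le_max_right 0 (p * c - deltaQ d q s)
  linarith

theorem stepSaving_zero (hd : IsHopCost d) (p : ℝ) (hq0 : 0 ≤ q) (hq1 : q ≤ 1) :
    stepSaving d p q 0 = fun _ => 0 := by
  funext s
  have := hd.deltaQ_nonneg hq0 hq1 s
  exact max_eq_left (by linarith)

theorem hasSum_geometric_mul (hp0 : 0 < p) (hp1 : p ≤ 1) (b : ℝ) :
    HasSum (fun k : ℕ => (1 - p) ^ k * (p * b)) b := by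
  have h := (hasSum_geometric_of_lt_one (sub_nonneg.2 hp1) (by linarith)).mul_right (p * b)
  rwa [sub_sub_cancel, inv_mul_cancel_left₀ hp0.ne'] at h

theorem iterate_meanNext_stepSaving_le (hd : IsHopCost d) (hp0 : 0 ≤ p) (hq0 : 0 ≤ q)
    (hq1 : q ≤ 1) (c : ℝ) (k : ℕ) (s : ℕ × ℕ) :
    (meanNext q)^[k] (stepSaving d p q c) s ≤ p * |c| := by
  have hzero : ∀ t, stepSaving d p q c t ≤ (fun _ => (0 : ℝ)) t + p * |c| := by
    intro t
    have h := stepSaving_le_add d hp0 q (abs_nonneg c) t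
    rw [stepSaving_zero hd p hq0 hq1, sub_zero] at h
    exact (stepSaving_mono d hp0 q (le_abs_self c) t).trans h
  have hconst : (meanNext q)^[k] (fun _ => (0 : ℝ)) = fun _ => 0 :=
    Function.iterate_fixed (funext fun t => meanNext_const q 0 t) k
  have h := iterate_meanNext_le_add hq0 hq1 hzero k s
  rwa [hconst, zero_add] at h

theorem summable_totalSaving (hd : IsHopCost d) (hp0 : 0 < p) (hp1 : p ≤ 1) (hq0 : 0 ≤ q)
    (hq1 : q ≤ 1) (c : ℝ) (s : ℕ × ℕ) :
    Summable fun k : ℕ => (1 - p) ^ k * (meanNext q)^[k] (stepSaving d p q c) s := by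
  have hp1' : 0 ≤ 1 - p := sub_nonneg.2 hp1
  refine Summable.of_nonneg_of_le (fun k => ?_) (fun k => ?_)
    (hasSum_geometric_mul hp0 hp1 |c|).summable
  · exact mul_nonneg (pow_nonneg hp1' k)
      (iterate_meanNext_nonneg hq0 hq1 (fun t => le_max_left _ _) k s)
  · exact mul_le_mul_of_nonneg_left
      (iterate_meanNext_stepSaving_le hd hp0.le hq0 hq1 c k s) (pow_nonneg hp1' k)

theorem totalSaving_nonneg (d : ℝ → ℝ) (hp1 : p ≤ 1) (hq0 : 0 ≤ q) (hq1 : q ≤ 1) (c : ℝ)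
    (s : ℕ × ℕ) : 0 ≤ totalSaving d p q c s :=
  tsum_nonneg fun k => mul_nonneg (pow_nonneg (sub_nonneg.2 hp1) k)
    (iterate_meanNext_nonneg hq0 hq1 (fun _ => le_max_left _ _) k s)

theorem totalSaving_mono (hd : IsHopCost d) (hp0 : 0 < p) (hp1 : p ≤ 1) (hq0 : 0 ≤ q)
    (hq1 : q ≤ 1) {c c' : ℝ} (h : c ≤ c') (s : ℕ × ℕ) :
    totalSaving d p q c s ≤ totalSaving d p q c' s := by
  refine (summable_totalSaving hd hp0 hp1 hq0 hq1 c s).tsum_le_tsum (fun k => ?_)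
    (summable_totalSaving hd hp0 hp1 hq0 hq1 c' s)
  refine mul_le_mul_of_nonneg_left ?_ (pow_nonneg (sub_nonneg.2 hp1) k)
  have := iterate_meanNext_le_add hq0 hq1 (u := stepSaving d p q c) (b := 0)
    (fun t => (stepSaving_mono d hp0.le q h t).trans (add_zero _).ge) k s
  rwa [add_zero] at this

theorem totalSaving_le_add (hd : IsHopCost d) (hp0 : 0 < p) (hp1 : p ≤ 1) (hq0 : 0 ≤ q)
    (hq1 : q ≤ 1) {c c' : ℝ} (h : c ≤ c') (s : ℕ × ℕ) :
    totalSaving d p q c' s ≤ totalSaving d p q c s + (c' - c) := by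
  have hsum := (summable_totalSaving hd hp0 hp1 hq0 hq1 c s).hasSum.add
    (hasSum_geometric_mul hp0 hp1 (c' - c))
  refine hasSum_le (fun k => ?_) (summable_totalSaving hd hp0 hp1 hq0 hq1 c' s).hasSum hsum
  rw [← mul_add]
  exact mul_le_mul_of_nonneg_left
    (iterate_meanNext_le_add hq0 hq1 (stepSaving_le_add d hp0.le q h) k s)
    (pow_nonneg (sub_nonneg.2 hp1) k)

theorem totalSaving_le (hd : IsHopCost d) (hp0 : 0 < p) (hp1 : p ≤ 1) (hq0 : 0 ≤ q)
    (hq1 : q ≤ 1) {c : ℝ} (hc : 0 ≤ c) (s : ℕ × ℕ) : totalSaving d p q c s ≤ c := by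
  have hsum := hasSum_geometric_mul hp0 hp1 |c|
  rw [abs_of_nonneg hc] at hsum
  refine hasSum_le (fun k => ?_) (summable_totalSaving hd hp0 hp1 hq0 hq1 c s).hasSum hsum
  have h := iterate_meanNext_stepSaving_le hd hp0.le hq0 hq1 c k s
  rw [abs_of_nonneg hc] at h
  exact mul_le_mul_of_nonneg_left h (pow_nonneg (sub_nonneg.2 hp1) k)

theorem totalSaving_eq (hd : IsHopCost d) (hp0 : 0 < p) (hp1 : p ≤ 1) (hq0 : 0 ≤ q)
    (hq1 : q ≤ 1) (c : ℝ) (s : ℕ × ℕ) : totalSaving d p q c s =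
      stepSaving d p q c s + (1 - p) * meanNext q (totalSaving d p q c) s := by
  have hsum := fun t => summable_totalSaving hd hp0 hp1 hq0 hq1 c t
  have hnext : HasSum (fun k : ℕ => (1 - p) ^ k *
      (meanNext q)^[k + 1] (stepSaving d p q c) s) (meanNext q (totalSaving d p q c) s) := by
    have h := ((hsum (move s Dir.east)).hasSum.mul_left q).add
      ((hsum (move s Dir.north)).hasSum.mul_left (1 - q))
    refine h.congr_fun fun k => ?_
    rw [Function.iterate_succ_apply', meanNext]
    ring
  rw [totalSaving, (hsum s).tsum_eq_zero_add, ← (hnext.mul_left (1 - p)).tsum_eq, pow_zero,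
    one_mul]
  congr 1
  refine tsum_congr fun k => ?_
  ring

theorem totalSaving_eq_zero (hd : IsHopCost d) (hq0 : 0 ≤ q) (hq1 : q ≤ 1) {c : ℝ} {s : ℕ × ℕ}
    (hs : p * c ≤ deltaQ d q s) : totalSaving d p q c s = 0 := by
  have key : ∀ (k : ℕ) (s : ℕ × ℕ), p * c ≤ deltaQ d q s →
      (meanNext q)^[k] (stepSaving d p q c) s = 0 := by
    intro k
    induction k with
    | zero => intro s hs; exact max_eq_left (sub_nonpos.2 hs)
    | succ k ih =>
      intro s hs
      rw [Function.iterate_succ_apply', meanNext, ih _ (hs.trans (hd.deltaQ_le_move hq0 hq1 s _)),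
        ih _ (hs.trans (hd.deltaQ_le_move hq0 hq1 s _))]
      ring
  simp [totalSaving, key _ s hs]

theorem stoppingValue_nonneg (hd : IsHopCost d) (hp0 : 0 < p) (hp1 : p ≤ 1) (hq0 : 0 ≤ q)
    (hq1 : q ≤ 1) {c : ℝ} (hc : 0 ≤ c) (s : ℕ × ℕ) : 0 ≤ stoppingValue d p q c s := by
  have h1 := totalSaving_le hd hp0 hp1 hq0 hq1 hc s
  have h2 := hd.latticeCost_pos s
  unfold stoppingValue
  linarith

theorem stoppingValue_le (d : ℝ → ℝ) (hp1 : p ≤ 1) (hq0 : 0 ≤ q) (hq1 : q ≤ 1) (c : ℝ)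
    (s : ℕ × ℕ) : stoppingValue d p q c s ≤ latticeCost d s + c :=
  sub_le_self _ (totalSaving_nonneg d hp1 hq0 hq1 c s)

theorem continuationCost_stoppingValue (d : ℝ → ℝ) (p q c : ℝ) (s : ℕ × ℕ) :
    continuationCost d p q (stoppingValue d p q c) s = latticeCost d s + deltaQ d q s +
      (1 - p) * (c - meanNext q (totalSaving d p q c) s) := by
  rw [← meanNext_latticeCost]
  simp only [continuationCost, stoppingValue, meanNext]
  ring

theorem stoppingValue_le_continuationCost (hd : IsHopCost d) (hp0 : 0 < p) (hp1 : p ≤ 1)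
    (hq0 : 0 ≤ q) (hq1 : q ≤ 1) (c : ℝ) (s : ℕ × ℕ) :
    stoppingValue d p q c s ≤ continuationCost d p q (stoppingValue d p q c) s := by
  have h := le_max_right 0 (p * c - deltaQ d q s)
  rw [continuationCost_stoppingValue, stoppingValue, totalSaving_eq hd hp0 hp1 hq0 hq1, stepSaving]
  linarith

theorem stoppingValue_of_le (hd : IsHopCost d) (hq0 : 0 ≤ q) (hq1 : q ≤ 1) {c : ℝ} {s : ℕ × ℕ}
    (hs : p * c ≤ deltaQ d q s) : stoppingValue d p q c s = latticeCost d s + c := by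
  rw [stoppingValue, totalSaving_eq_zero hd hq0 hq1 hs, sub_zero]

theorem stoppingValue_of_not_le (hd : IsHopCost d) (hp0 : 0 < p) (hp1 : p ≤ 1) (hq0 : 0 ≤ q)
    (hq1 : q ≤ 1) {c : ℝ} {s : ℕ × ℕ} (hs : ¬ p * c ≤ deltaQ d q s) :
    stoppingValue d p q c s = continuationCost d p q (stoppingValue d p q c) s := by
  have h : stepSaving d p q c s = p * c - deltaQ d q s :=
    max_eq_right (sub_nonneg.2 (not_le.1 hs).le)
  rw [continuationCost_stoppingValue, stoppingValue, totalSaving_eq hd hp0 hp1 hq0 hq1, h]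
  ring

/-- The optimal expected cost of ending a single hop that starts at the origin, when a placement
costs `c` in addition to the hop cost and no relay may be placed before the first step. -/
noncomputable def firstHopValue (d : ℝ → ℝ) (p q c : ℝ) : ℝ :=
  continuationCost d p q (stoppingValue d p q c) (0, 0)

theorem firstHopValue_nonneg (hd : IsHopCost d) (hp0 : 0 < p) (hp1 : p ≤ 1) (hq0 : 0 ≤ q)
    (hq1 : q ≤ 1) {c : ℝ} (hc : 0 ≤ c) : 0 ≤ firstHopValue d p q c :=
  continuationCost_nonneg hd hp0.le hp1 hq0 hq1 (stoppingValue_nonneg hd hp0 hp1 hq0 hq1 hc) _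

theorem firstHopValue_mono (hd : IsHopCost d) (hp0 : 0 < p) (hp1 : p ≤ 1) (hq0 : 0 ≤ q)
    (hq1 : q ≤ 1) {c c' : ℝ} (h : c ≤ c') : firstHopValue d p q c ≤ firstHopValue d p q c' := by
  have h1 := meanNext_mono hq0 hq1
    (v := fun t => totalSaving d p q c t + (c' - c))
    (totalSaving_le_add hd hp0 hp1 hq0 hq1 h) (0, 0)
  rw [meanNext_add_const] at h1
  rw [firstHopValue, firstHopValue, continuationCost_stoppingValue,
    continuationCost_stoppingValue]
  gcongr _ + ?_
  exact mul_le_mul_of_nonneg_left (by linarith) (sub_nonneg.2 hp1)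

theorem firstHopValue_le_add (hd : IsHopCost d) (hp0 : 0 < p) (hp1 : p ≤ 1) (hq0 : 0 ≤ q)
    (hq1 : q ≤ 1) {c c' : ℝ} (h : c ≤ c') :
    firstHopValue d p q c' ≤ firstHopValue d p q c + (1 - p) * (c' - c) := by
  have h1 := meanNext_mono hq0 hq1 (totalSaving_mono hd hp0 hp1 hq0 hq1 h) (0, 0)
  rw [firstHopValue, firstHopValue, continuationCost_stoppingValue,
    continuationCost_stoppingValue, add_assoc _ (_ * _), ← mul_add]
  gcongr _ + ?_
  exact mul_le_mul_of_nonneg_left (by linarith) (sub_nonneg.2 hp1)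

/-- `h ↦ firstHopValue d p q (lam + h)` is a contraction with factor `1 - p`, and its fixed point
is nonnegative. -/
theorem exists_firstHopValue_fixedPoint (hd : IsHopCost d) (hp0 : 0 < p) (hp1 : p ≤ 1)
    (hq0 : 0 ≤ q) (hq1 : q ≤ 1) {lam : ℝ} (hlam : 0 ≤ lam) :
    ∃ h : ℝ≥0, firstHopValue d p q (lam + h) = h := by
  have hp1' : 0 ≤ 1 - p := sub_nonneg.2 hp1
  have hcontr : ContractingWith (NNReal.mk (1 - p) hp1') fun h : ℝ => firstHopValue d p q (lam + h) := by
    refine ⟨by rw [← NNReal.coe_lt_coe]; exact sub_lt_self 1 hp0,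
      LipschitzWith.of_dist_le_mul fun x y => ?_⟩
    rw [NNReal.coe_mk]
    wlog hxy : x ≤ y generalizing x y
    · rw [dist_comm, dist_comm x]
      exact this y x (le_of_not_ge hxy)
    have hxy' : lam + x ≤ lam + y := by linarith
    have h1 := firstHopValue_mono hd hp0 hp1 hq0 hq1 hxy'
    have h2 := firstHopValue_le_add hd hp0 hp1 hq0 hq1 hxy'
    rw [dist_comm, dist_comm x, Real.dist_eq, Real.dist_eq, abs_of_nonneg (sub_nonneg.2 h1),
      abs_of_nonneg (sub_nonneg.2 hxy)]
    linarith
  have hfix : firstHopValue d p q (lam + hcontr.fixedPoint) = hcontr.fixedPoint :=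
    hcontr.fixedPoint_isFixedPt
  have hnonneg : 0 ≤ hcontr.fixedPoint := by
    by_contra! hneg
    have h1 := firstHopValue_le_add hd hp0 hp1 hq0 hq1
      (add_le_add_right hneg.le lam : lam + hcontr.fixedPoint ≤ lam + 0)
    have h2 := firstHopValue_nonneg hd hp0 hp1 hq0 hq1 (by linarith : 0 ≤ lam + 0)
    rw [hfix] at h1
    linarith [mul_neg_of_pos_of_neg hp0 hneg]
  exact ⟨NNReal.mk _ hnonneg, hfix⟩

/-! ### The cost of the one-step-look-ahead policies -/

theorem g_ne_top (hd : IsHopCost d) (hp0 : 0 < p) (hp1 : p ≤ 1) (hq0 : 0 ≤ q) (hq1 : q ≤ 1)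
    {lam : ℝ} (hlam : 0 ≤ lam) (h : ℝ≥0) : g d p q lam h ≠ ∞ := by
  have hp1' : 0 ≤ 1 - p := sub_nonneg.2 hp1
  set c := lam + (h : ℝ) with hc_def
  have hc : 0 ≤ c := add_nonneg hlam h.2
  set F := firstHopValue d p q c with hF
  -- The shift `b` solves `p * b = F - h`: on the placement set, the value of the stopping problem
  -- charges `h` for what follows a relay, where the policy needs `F + (1 - p) * b`.
  obtain ⟨b, hb, hFb⟩ : ∃ b : ℝ, 0 ≤ b ∧ F + (1 - p) * b ≤ h + b := by
    refine ⟨max 0 ((F - h) / p), le_max_left _ _, ?_⟩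
    have := (div_le_iff₀ hp0).1 (le_max_right 0 ((F - h) / p))
    linarith
  have hle := costToGo_placementPolicy_le_of_supersolution hd hp0 hp1 hq0 hq1 hlam
    (placementSet d p q lam h) (v := fun s => stoppingValue d p q c s + b)
    (fun s => add_nonneg (stoppingValue_nonneg hd hp0 hp1 hq0 hq1 hc s) hb)
    (fun s hs => by
      rw [continuationCost_add_const, stoppingValue_of_le hd hq0 hq1 hs]
      change _ + (F + _) ≤ _
      linarith)
    (fun s hs => by
      rw [continuationCost_add_const, ← stoppingValue_of_not_le hd hp0 hp1 hq0 hq1 hs]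
      linarith [mul_nonneg hp0.le hb])
    (0, 0)
  exact ne_top_of_le_ne_top ENNReal.ofReal_ne_top hle

/-- If the value `F` of the stopping problem with continuation charge `h` does not exceed `h`, then
the charge overestimates what follows a relay, and the placement set `𝒫(h)` costs at most `F`. -/
theorem g_le_firstHopValue (hd : IsHopCost d) (hp0 : 0 < p) (hp1 : p ≤ 1) (hq0 : 0 ≤ q)
    (hq1 : q ≤ 1) {lam : ℝ} (hlam : 0 ≤ lam) {h : ℝ≥0}
    (hF : firstHopValue d p q (lam + h) ≤ h) :
    g d p q lam h ≤ ENNReal.ofReal (firstHopValue d p q (lam + h)) := by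
  have hc : 0 ≤ lam + (h : ℝ) := add_nonneg hlam h.2
  have hle := costToGo_placementPolicy_le_of_supersolution hd hp0 hp1 hq0 hq1 hlam
    (placementSet d p q lam h) (stoppingValue_nonneg hd hp0 hp1 hq0 hq1 hc)
    (fun s hs => by
      rw [stoppingValue_of_le hd hq0 hq1 hs]
      change _ + firstHopValue d p q (lam + h) ≤ _
      linarith)
    (fun s hs => (stoppingValue_of_not_le hd hp0 hp1 hq0 hq1 hs).ge) (0, 0)
  exact hle.trans (ENNReal.ofReal_le_ofReal
    (stoppingValue_le_continuationCost hd hp0 hp1 hq0 hq1 _ _))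

/-- A fixed point of the value of the stopping problem is a lower bound for the cost of every
policy: charging `h` for what follows a relay is then exact. -/
theorem le_optimalCostToGo_of_firstHopValue_eq (hd : IsHopCost d) (hp0 : 0 < p) (hp1 : p ≤ 1)
    (hq0 : 0 ≤ q) (hq1 : q ≤ 1) {lam : ℝ} (hlam : 0 ≤ lam) {h : ℝ≥0}
    (hF : firstHopValue d p q (lam + h) = h) :
    (h : ℝ≥0∞) ≤ optimalCostToGo d p q lam (0, 0) := by
  have hc : 0 ≤ lam + (h : ℝ) := add_nonneg hlam h.2
  have hle := stoppingValue_le d hp1 hq0 hq1 (lam + (h : ℝ))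
  have hzero : (h : ℝ) ≤ stoppingValue d p q (lam + h) (0, 0) := by
    by_cases h0 : p * (lam + (h : ℝ)) ≤ deltaQ d q (0, 0)
    · rw [stoppingValue_of_le hd hq0 hq1 h0]
      linarith [hd.latticeCost_pos (0, 0)]
    · rw [stoppingValue_of_not_le hd hp0 hp1 hq0 hq1 h0]
      exact hF.ge
  refine le_iInf fun π => ?_
  rw [← ENNReal.ofReal_coe_nnreal]
  refine (ENNReal.ofReal_le_ofReal hzero).trans ?_
  refine le_costToGo_of_subsolution hd hp0 hp1 hq0 hq1 hlam
    (stoppingValue_nonneg hd hp0 hp1 hq0 hq1 hc) hc hle (fun s => ?_)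
    (stoppingValue_le_continuationCost hd hp0 hp1 hq0 hq1 _) π (0, 0)
  change _ ≤ _ + firstHopValue d p q (lam + h)
  linarith [hle s]

end RelayPlacement

theorem mainTheorem4 (d : ℝ → ℝ) (hd : RelayPlacement.IsHopCost d) (p q lam : ℝ)
    (hp0 : 0 < p) (hp1 : p < 1) (hq0 : 0 ≤ q) (hq1 : q ≤ 1) (hlam : 0 ≤ lam) :
    (∀ h : ℝ≥0, RelayPlacement.g d p q lam h ≠ ∞) ∧
    ∃ gStar : ℝ≥0,
      (gStar : ℝ≥0∞) = RelayPlacement.optimalCostToGo d p q lam (0, 0) ∧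
      IsLeast (Set.range (RelayPlacement.g d p q lam)) (gStar : ℝ≥0∞) ∧
      RelayPlacement.g d p q lam gStar = (gStar : ℝ≥0∞) ∧
      (∀ h : ℝ≥0, RelayPlacement.g d p q lam h = (h : ℝ≥0∞) → h = gStar) ∧
      (∀ h : ℝ≥0, gStar < h → RelayPlacement.g d p q lam h < (h : ℝ≥0∞)) := by
  refine ⟨RelayPlacement.g_ne_top hd hp0 hp1.le hq0 hq1 hlam, ?_⟩
  obtain ⟨gStar, hfix⟩ :=
    RelayPlacement.exists_firstHopValue_fixedPoint hd hp0 hp1.le hq0 hq1 hlam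
  have hlower := RelayPlacement.le_optimalCostToGo_of_firstHopValue_eq hd hp0 hp1.le hq0 hq1 hlam
    hfix
  have hopt : ∀ h : ℝ≥0,
      RelayPlacement.optimalCostToGo d p q lam (0, 0) ≤ RelayPlacement.g d p q lam h :=
    fun h => iInf_le _ _
  have hupper : RelayPlacement.g d p q lam gStar ≤ (gStar : ℝ≥0∞) := by
    have := RelayPlacement.g_le_firstHopValue hd hp0 hp1.le hq0 hq1 hlam hfix.le
    rwa [hfix, ENNReal.ofReal_coe_nnreal] at this
  have hgfix : RelayPlacement.g d p q lam gStar = (gStar : ℝ≥0∞) :=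
    le_antisymm hupper (hlower.trans (hopt gStar))
  have hlt : ∀ h : ℝ≥0, gStar < h → RelayPlacement.g d p q lam h < (h : ℝ≥0∞) := by
    intro h hh
    have hh' : (gStar : ℝ) < h := NNReal.coe_lt_coe.2 hh
    -- the contraction moves `h` strictly towards the fixed point
    have hF : RelayPlacement.firstHopValue d p q (lam + h) < h := by
      have := RelayPlacement.firstHopValue_le_add hd hp0 hp1.le hq0 hq1
        (add_le_add_right hh'.le lam)
      rw [hfix] at this
      linarith [mul_pos hp0 (sub_pos.2 hh')]
    refine (RelayPlacement.g_le_firstHopValue hd hp0 hp1.le hq0 hq1 hlam hF.le).trans_lt ?_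
    rw [← ENNReal.ofReal_coe_nnreal]
    exact (ENNReal.ofReal_lt_ofReal_iff_of_nonneg (RelayPlacement.firstHopValue_nonneg hd hp0
      hp1.le hq0 hq1 (add_nonneg hlam h.2))).2 hF
  refine ⟨gStar, le_antisymm hlower ((hopt gStar).trans hupper), ⟨⟨gStar, hgfix⟩, ?_⟩, hgfix,
    fun h hh => ?_, hlt⟩
  · rintro _ ⟨h, rfl⟩
    exact hlower.trans (hopt h)
  · refine le_antisymm (le_of_not_gt fun hgt => (hlt h hgt).ne hh) ?_
    rw [← ENNReal.coe_le_coe, ← hh]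
    exact hlower.trans (hopt h)
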